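/- All Hilbert spaces are finite-dimensional and complex. An object of $\mathrm{2FHilb}$ is a finite index set ($[1]$ denotes a one-point set, and $A\boxtimes B=A\times B$). A 1-morphism $H:A\to B$ is a family of Hilbert spaces $(H_{ab})_{a\in A,b\in B}$, and a 2-morphism $f:H\to K$ is a family of linear maps $f_{ab}:H_{ab}\to K_{ab}$, with componentwise composition and dagger; $f$ is an isometry if $f^\dagger f=\mathrm{id}$. Write $(H\otimes K)_{ac}=\bigoplus_b H_{ab}\otimes K_{bc}$ and $(H\boxtimes K)_{(a,c)(b,d)}=H_{ab}\otimes K_{cd}$, and let $H^*$ be the same family with source and target exchanged. For $H:[1]\to A$, $\mathrm{End}(H)=\bigoplus_{a}B(H_a)$, and $\hat H:[1]\to A$ is $B_A\otimes(H^*\boxtimes \mathrm{id}_A)$, where $B_A:[1]\to A\boxtimes A$ is $\mathbb C$ on the diagonal and $0$ off it (so $\hat H_a\cong H_a$). A completely positive (CP) map $\mathcal F:\mathrm{End}(H)\to\mathrm{End}(K)$, with $H:[1]\to A$ and $K:[1]\to B$, has Stinespring representation $(E,V)$, where $E:A\to B$ and $V:K\to H\otimes E$, if $\mathcal F(x)=V^\dagger(x\otimes\mathrm{id}_E)V$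 for all $x$. It is minimal if the 2-morphism $E\to E$ with components $\mathrm{Tr}_{H_a}\big((V_bV_b^\dagger)_{aa}\big)$ is invertible. Let $H_{\mathrm{in}}:[1]\to[m]$, $H_{\mathrm{out}}:[1]\to[n]$, $K_{\mathrm{in}}:[1]\to[m']$, $K_{\mathrm{out}}:[1]\to[n']$ be 1-morphisms. Let $\mathcal S:\mathrm{End}(H_{\mathrm{out}}\boxtimes\widehat{H_{\mathrm{in}}})\to\mathrm{End}(K_{\mathrm{out}}\boxtimes\widehat{K_{\mathrm{in}}})$ be a deterministic supermap, i.e. a CP map such that for every positive $x$, $\mathrm{Tr}_{H_{\mathrm{out}}}x=\mathrm{id}$ implies $\mathrm{Tr}_{K_{\mathrm{out}}}\mathcal S(x)=\mathrm{id}$. Theorem. There is a unital CP map $\mathcal N:\mathrm{End}(\widehat{H_{\mathrm{in}}})\to\mathrm{End}(\widehat{K_{\mathrm{in}}})$ with $\mathrm{Tr}_{K_{\mathrm{out}}}\mathcal S(C)=\mathcal N(\mathrm{Tr}_{H_{\mathrm{out}}}C)$ for all $C$, and a minimal Stinespring representation $(E_N,N)$ of $\mathcal N$, with $N:\widehat{K_{\mathrm{in}}}\to\widehat{H_{\mathrm{in}}}\otimes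 E_N$ an isometry, such that the following holds. There are a 1-morphism $E:[n]\boxtimes[m]\to[n']\boxtimes[m']$ and an isometry $$W:H_{\mathrm{out}}^*\boxtimes E_N\to E\otimes(K_{\mathrm{out}}^*\boxtimes\mathrm{id}_{[m']}),\qquad W_{ji,k}:H_{\mathrm{out},j}\otimes E_{N,ik}\to\bigoplus_{l}E_{(j,i),(l,k)}\otimes K_{\mathrm{out},l},$$ such that $\mathcal S(C)=V^\dagger(C\otimes\mathrm{id}_E)V$ for all $C$, where $V:K_{\mathrm{out}}\boxtimes\widehat{K_{\mathrm{in}}}\to(H_{\mathrm{out}}\boxtimes\widehat{H_{\mathrm{in}}})\otimes E$ is the 2-morphism obtained by applying $N$ to the wire $\widehat{K_{\mathrm{in}}}$, creating a pair of wires $H_{\mathrm{out}},H_{\mathrm{out}}^*$ with the cup of $H_{\mathrm{out}}$, applying $W$ to the wires $H_{\mathrm{out}}^*,E_N$, and closing the output wire $K_{\mathrm{out}}^*$ of $W$ with the input wire $K_{\mathrm{out}}$ by the cap of $K_{\mathrm{out}}$. In components, for orthonormal bases $|a\rangle$ of $H_{\mathrm{out},j}$ and $|b\rangle$ of $K_{\mathrm{out},l}$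 (which fix the cup $1\mapsto\sum_a|a\rangle\otimes|a\rangle$ and the cap $|b\rangle\otimes|b'\rangle\mapsto\langle b|b'\rangle$, and may be chosen arbitrarily), $$V_{(l,k)}=\bigoplus_{j,i}\ \sum_{a,b}\Big(\big(|a\rangle\otimes\mathrm{id}_{\widehat{H_{\mathrm{in}}}_{,i}}\big)\otimes(\mathrm{id}\otimes\langle b|)\,W^{l}_{ji,k}\,(|a\rangle\otimes\mathrm{id}_{E_{N,ik}})\Big)\,N_{k}^{i}\,(\langle b|\otimes\mathrm{id}_{\widehat{K_{\mathrm{in}}}_{,k}}),$$ with $W^l_{ji,k}$ and $N^i_k$ the components of $W_{ji,k}$ and $N_k$ in the summands $l$ and $i$. Moreover, with the same $(E_N,N)$, every Stinespring representation $(E,V)$ of $\mathcal S$ is of this form for some isometry $W$. -/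

import Mathlib

open scoped TensorProduct InnerProductSpace CStarAlgebra

universe u

noncomputable section

namespace TwoFHilb

/-! ### Finite-dimensional Hilbert spaces -/

/-- A finite-dimensional complex Hilbert space. -/
structure FHilb : Type (u + 1) where
  carrier : Type u
  [normed : NormedAddCommGroup carrier]
  [inner : InnerProductSpace ℂ carrier]
  [finite : FiniteDimensional ℂ carrier]

instance : CoeSort FHilb.{u} (Type u) := ⟨FHilb.carrier⟩

attribute [instance] FHilb.normed FHilb.inner FHilb.finite

instance (X : FHilb.{u}) : CompleteSpace X := FiniteDimensional.complete ℂ X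

namespace FHilb

/-- Tensor product of Hilbert spaces. -/
abbrev tensor (X Y : FHilb.{u}) : FHilb.{u} := ⟨X ⊗[ℂ] Y⟩

/-- Orthogonal direct sum of a finite family of Hilbert spaces. -/
abbrev sum {B : Type} [Fintype B] (X : B → FHilb.{u}) : FHilb.{u} := ⟨PiLp 2 fun b => X b⟩

/-- The Hilbert space which is `ℂ` if `p` holds and zero otherwise. -/
abbrev ofProp (p : Prop) [Decidable p] : FHilb.{u} := ⟨EuclideanSpace ℂ (ULift.{u} (PLift p))⟩

/-- The inclusion of a summand in an orthogonal direct sum. -/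
def incl {B : Type} [Fintype B] [DecidableEq B] (X : B → FHilb.{u}) (b : B) : X b →L[ℂ] sum X :=
  LinearMap.toContinuousLinearMap
    ((WithLp.linearEquiv 2 ℂ (∀ b, X b)).symm.toLinearMap ∘ₗ LinearMap.single ℂ (fun b => X b) b)

/-- The projection of an orthogonal direct sum on a summand. -/
def proj {B : Type} [Fintype B] (X : B → FHilb.{u}) (b : B) : sum X →L[ℂ] X b :=
  PiLp.proj 2 (fun b => X b) b

/-- `|x⟩ ⊗ id : Y → X ⊗ Y`. -/
def ketL {X : FHilb.{u}} (x : X) (Y : FHilb.{u}) : Y →L[ℂ] tensor X Y :=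
  LinearMap.toContinuousLinearMap (TensorProduct.mk ℂ X Y x)

/-- `id ⊗ |x⟩ : Y → Y ⊗ X`. -/
def ketR {X : FHilb.{u}} (x : X) (Y : FHilb.{u}) : Y →L[ℂ] tensor Y X :=
  LinearMap.toContinuousLinearMap ((TensorProduct.mk ℂ Y X).flip x)

/-- `⟨x| ⊗ id : X ⊗ Y → Y`. -/
def braL {X : FHilb.{u}} (x : X) (Y : FHilb.{u}) : tensor X Y →L[ℂ] Y := (ketL x Y).adjoint

/-- `id ⊗ ⟨x| : Y ⊗ X → Y`. -/
def braR {X : FHilb.{u}} (x : X) (Y : FHilb.{u}) : tensor Y X →L[ℂ] Y := (ketR x Y).adjoint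

/-- The partial trace over `X` of an operator on `X ⊗ Y`
(the value does not depend on the orthonormal basis). -/
def ptrace {X Y : FHilb.{u}} (f : tensor X Y →L[ℂ] tensor X Y) : Y →L[ℂ] Y :=
  ∑ a, braL (stdOrthonormalBasis ℂ X a) Y ∘L f ∘L ketL (stdOrthonormalBasis ℂ X a) Y

end FHilb

/-! ### The 2-category of finite-dimensional 2-Hilbert spaces

Objects are finite index sets; the object `[1]` is `Unit`, and the composite `A ⊠ B` of objects
is `A × B`. -/

/-- A 1-morphism `A → B`: a family of finite-dimensional Hilbert spaces. -/
abbrev OneMor (A B : Type) : Type (u + 1) := A → B → FHilb.{u}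

/-- A 2-morphism `H → K`: a family of linear maps. -/
abbrev TwoMor {A B : Type} (H K : OneMor.{u} A B) : Type u := ∀ a b, H a b →L[ℂ] K a b

section OneMor

variable {A B C D : Type}

/-- The identity 1-morphism. -/
def OneMor.ident (A : Type) [DecidableEq A] : OneMor.{u} A A := fun a a' => FHilb.ofProp (a = a')

/-- Horizontal composition `H ⊗ K`. -/
abbrev OneMor.comp [Fintype B] (H : OneMor.{u} A B) (K : OneMor.{u} B C) : OneMor.{u} A C :=
  fun a c => FHilb.sum fun b => FHilb.tensor (H a b) (K b c)

/-- Layering `H ⊠ K`. -/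
abbrev OneMor.box (H : OneMor.{u} A B) (K : OneMor.{u} C D) : OneMor.{u} (A × C) (B × D) :=
  fun p q => FHilb.tensor (H p.1 q.1) (K p.2 q.2)

/-- Layering `H ⊠ K` of 1-morphisms out of `[1]`, with `[1] ⊠ [1]` identified with `[1]`. -/
abbrev OneMor.box₁ (H : OneMor.{u} Unit B) (K : OneMor.{u} Unit D) : OneMor.{u} Unit (B × D) :=
  fun _ q => FHilb.tensor (H () q.1) (K () q.2)

/-- The dual 1-morphism `H^*`: the same Hilbert spaces with source and target exchanged. -/
abbrev OneMor.dual (H : OneMor.{u} A B) : OneMor.{u} B A := fun b a => H a b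

/-- The bend `B_A : [1] → A ⊠ A`, which is `ℂ` on the diagonal and zero elsewhere. -/
def OneMor.bend (A : Type) [DecidableEq A] : OneMor.{u} Unit (A × A) :=
  fun _ p => FHilb.ofProp (p.1 = p.2)

/-- The 1-morphism `Ĥ = B_A ⊗ (H^* ⊠ id_A) : [1] → A` of a 1-morphism `H : [1] → A`,
with `[1] ⊠ A` identified with `A`. -/
def OneMor.hat [Fintype A] [DecidableEq A] (H : OneMor.{u} Unit A) : OneMor.{u} Unit A :=
  fun _ a => (OneMor.bend A).comp (H.dual.box (OneMor.ident A)) () ((), a)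

end OneMor

section TwoMor

variable {A B C : Type} {H K L : OneMor.{u} A B}

/-- Vertical composition. -/
def TwoMor.comp (g : TwoMor K L) (f : TwoMor H K) : TwoMor H L := fun a b => g a b ∘L f a b

/-- The dagger. -/
def TwoMor.dagger (f : TwoMor H K) : TwoMor K H := fun a b => (f a b).adjoint

/-- The identity 2-morphism. -/
def TwoMor.id (H : OneMor.{u} A B) : TwoMor H H := fun a b => ContinuousLinearMap.id ℂ (H a b)

/-- A 2-morphism `f` is an isometry if `f† ∘ f = id`. -/
def TwoMor.IsIsometry (f : TwoMor H K) : Prop := f.dagger.comp f = TwoMor.id H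

/-- The horizontal composition `x ⊗ id_E` with an identity 2-morphism. -/
def TwoMor.whisker [Fintype B] [DecidableEq B] (x : TwoMor H K) (E : OneMor.{u} B C) :
    TwoMor (H.comp E) (K.comp E) :=
  fun a c => ∑ b, FHilb.incl (fun b => FHilb.tensor (K a b) (E b c)) b ∘L
    (x a b).rTensor (E b c) ∘L FHilb.proj (fun b => FHilb.tensor (H a b) (E b c)) b

end TwoMor

/-! ### Endomorphism algebras, completely positive maps and their dilations -/

/-- The finite-dimensional C⋆-algebra of 2-morphisms `H → H`. Product, star and order are the
componentwise ones, so `0 ≤ x` means that all components are positive operators. -/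
abbrev EndAlg {A B : Type} (H : OneMor.{u} A B) : Type u := ∀ a b, H a b →L[ℂ] H a b

section Stinespring

variable {A B : Type} [Fintype A] [DecidableEq A] [Fintype B]
  {H : OneMor.{u} Unit A} {K : OneMor.{u} Unit B}

/-- `(E, V)` is a Stinespring representation of `F`: `F x = V† ∘ (x ⊗ id_E) ∘ V`. -/
def IsStinespring (F : EndAlg H →CP EndAlg K) (E : OneMor.{u} A B) (V : TwoMor K (H.comp E)) :
    Prop :=
  ∀ x : EndAlg H, F x = V.dagger.comp ((TwoMor.whisker x E).comp V)

/-- The 2-morphism `E → E` obtained from `V ∘ V† : H ⊗ E → H ⊗ E` by tracing out the wire `H`;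
the wire `K` bounds a closed region on its left and the open region `B` on its right. -/
def envGram (E : OneMor.{u} A B) (V : TwoMor K (H.comp E)) : TwoMor E E :=
  fun a b => FHilb.ptrace
    (FHilb.proj (fun a => FHilb.tensor (H () a) (E a b)) a ∘L V () b ∘L (V () b).adjoint ∘L
      FHilb.incl (fun a => FHilb.tensor (H () a) (E a b)) a)

/-- A Stinespring representation is minimal if the 2-morphism `envGram E V` is invertible. -/
def IsMinimalStinespring (F : EndAlg H →CP EndAlg K) (E : OneMor.{u} A B)
    (V : TwoMor K (H.comp E)) : Prop :=
  IsStinespring F E V ∧ ∃ g : TwoMor E E,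
    g.comp (envGram E V) = TwoMor.id E ∧ (envGram E V).comp g = TwoMor.id E

end Stinespring

/-! ### Supermaps -/

section Supermap

variable {m n m' n' : Type} [Fintype m] [DecidableEq m] [Fintype n] [DecidableEq n]
  [Fintype m'] [DecidableEq m'] [Fintype n'] [DecidableEq n']

/-- The partial trace `Tr_K : End(K ⊠ L) → End(L)` over the front-most left factor. -/
def trOut (K : OneMor.{u} Unit n) (L : OneMor.{u} Unit m) (x : EndAlg (K.box₁ L)) : EndAlg L :=
  fun _ i => ∑ j, FHilb.ptrace (x () (j, i))

/-- The Choi algebra `End(K ⊠ Ĥ)`, whose positive elements are the Choi operators of the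
completely positive maps `End(H) → End(K)`. -/
abbrev ChoiAlg (K : OneMor.{u} Unit n) (H : OneMor.{u} Unit m) : Type u := EndAlg (K.box₁ H.hat)

/-- The condition (TP): the completely positive map with Choi operator `x` is trace preserving. -/
def IsTP (K : OneMor.{u} Unit n) (H : OneMor.{u} Unit m) (x : ChoiAlg K H) : Prop :=
  trOut K H.hat x = 1

/-- A completely positive map of Choi algebras is a deterministic supermap if it sends positive
elements obeying (TP) to (positive) elements obeying (TP). -/
def IsDeterministicSupermap {HOut : OneMor.{u} Unit n} {HIn : OneMor.{u} Unit m}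
    {KOut : OneMor.{u} Unit n'} {KIn : OneMor.{u} Unit m'}
    (S : ChoiAlg HOut HIn →CP ChoiAlg KOut KIn) : Prop :=
  ∀ x : ChoiAlg HOut HIn, 0 ≤ x → IsTP HOut HIn x → IsTP KOut KIn (S x)

/-- The source `H^* ⊠ E_N : n ⊠ m → m'` of `W`, with `[1] ⊠ m'` identified with `m'`. -/
abbrev preEnv (HOut : OneMor.{u} Unit n) (EN : OneMor.{u} m m') : OneMor.{u} (n × m) m' :=
  fun p k => FHilb.tensor (HOut () p.1) (EN p.2 k)

/-- The target `E ⊗ (K^* ⊠ id_{m'}) : n ⊠ m → m'` of `W`. The region `n'` is closed, so its index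
is summed over; the identity 1-morphism of `m'` forces the two indices in `m'` to agree. -/
abbrev postEnv (E : OneMor.{u} (n × m) (n' × m')) (KOut : OneMor.{u} Unit n') :
    OneMor.{u} (n × m) m' :=
  fun p k => FHilb.sum fun l => FHilb.tensor (E p (l, k)) (KOut () l)

/-- A choice of orthonormal bases for the components of a 1-morphism, which fixes its cup
`1 ↦ ∑ a, |a⟩ ⊗ |a⟩` and its cap `|a⟩ ⊗ |b⟩ ↦ ⟨a|b⟩`. -/
abbrev Bases (H : OneMor.{u} Unit n) : Type u :=
  ∀ j, OrthonormalBasis (Fin (Module.finrank ℂ (H () j))) ℂ (H () j)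

/-- The 2-morphism `K_out ⊠ K̂_in → (H_out ⊠ Ĥ_in) ⊗ E` (here `P = Ĥ_in` and `Q = K̂_in`) built from
`N : Q → P ⊗ E_N` and `W : H_out^* ⊠ E_N → E ⊗ (K_out^* ⊠ id)` as follows. Apply `N` to the wire
`Q`; create a pair of wires `H_out`, `H_out^*` with the cup of `H_out`; feed the wires `H_out^*` and
`E_N` to `W`; annihilate the output wire `K_out^*` of `W` against the input wire `K_out` with the
cap of `K_out`. The indices of the open regions are `l : n'` and `k : m'`, those of the closed
regions `j : n` and `i : m`. The sum over `a` is the cup, the sum over `b` is the cap. -/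
def supermapDilation {HOut : OneMor.{u} Unit n} {P : OneMor.{u} Unit m}
    {KOut : OneMor.{u} Unit n'} {Q : OneMor.{u} Unit m'}
    (bH : Bases HOut) (bK : Bases KOut)
    {EN : OneMor.{u} m m'} (N : TwoMor Q (P.comp EN))
    {E : OneMor.{u} (n × m) (n' × m')} (W : TwoMor (preEnv HOut EN) (postEnv E KOut)) :
    TwoMor (KOut.box₁ Q) ((HOut.box₁ P).comp E) :=
  fun _ lk => ∑ ji : n × m, ∑ a, ∑ b,
    FHilb.incl (fun ji : n × m => FHilb.tensor (FHilb.tensor (HOut () ji.1) (P () ji.2)) (E ji lk))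
        ji ∘L
      TensorProduct.mapL
        (FHilb.ketL (bH ji.1 a) (P () ji.2))
        (FHilb.braR (bK lk.1 b) (E ji lk) ∘L
          FHilb.proj (fun l => FHilb.tensor (E ji (l, lk.2)) (KOut () l)) lk.1 ∘L
          W ji lk.2 ∘L FHilb.ketL (bH ji.1 a) (EN ji.2 lk.2)) ∘L
      FHilb.proj (fun i => FHilb.tensor (P () i) (EN i lk.2)) ji.2 ∘L
      N () lk.2 ∘L
      FHilb.braL (bK lk.1 b) (Q () lk.2)

end Supermap

end TwoFHilb

end

noncomputable section

namespace TwoFHilb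

/-! ### Tensor products and direct sums of Hilbert spaces in coordinates -/

namespace FHilb

open InnerProductSpace

variable {X Y Z : FHilb.{u}}

/-! Two facts carry the proof.

Reduction (`exists_reduction`): let `R` be the partial trace after `S`. It sends every positive `x`
with `Tr x = 1` to `1`. A self-adjoint `x` with `Tr x = 0` becomes positive after adding a large
multiple of the identity, which changes its trace only by a known scalar; comparing with the
identity alone gives `R x = 0`. So `R` factors through the partial trace. Composing `R` with the
section `y ↦ d⁻¹ (id ⊠ y)`, where `d` is the total dimension of `H_out`, gives a unital CP map `𝒩`.

Comparison of dilations (`exists_eq_supermapDilation`): a Stinespring representation amounts to a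
family of vectors `leg x y` in the environment, the components `⟨x| V |y⟩`, whose inner products are
`⟨y, F(|x⟩⟨x'|) y'⟩`. For a dilation `V` of `S`, summing these inner products over a basis of
`K_out` produces `Tr S`, hence `𝒩 ∘ Tr`. The legs of `V`, assembled over `K_out`, therefore have the
same Gram matrix as the vectors `|a⟩ ⊗ leg` built from `N`. When the legs of `N` span, these vectors
span `H_out ⊗ E_N`, and equality of Gram matrices yields the isometry `W`. Spanning legs also make
`N` minimal (`exists_inverse_envGram`), and `exists_stinespring` supplies such a representation for
every CP map. -/

@[simp] lemma ketL_apply (x : X) (y : Y) : ketL x Y y = x ⊗ₜ[ℂ] y := rfl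

@[simp] lemma ketR_apply (x : X) (y : Y) : ketR x Y y = y ⊗ₜ[ℂ] x := rfl

@[simp] lemma braL_tmul (x x' : X) (y : Y) : braL x Y (x' ⊗ₜ[ℂ] y) = ⟪x, x'⟫_ℂ • y := by
  refine ext_inner_left ℂ fun z => ?_
  rw [braL, ContinuousLinearMap.adjoint_inner_right, ketL_apply, TensorProduct.inner_tmul,
    inner_smul_right]

@[simp] lemma braR_tmul (x x' : X) (y : Y) : braR x Y (y ⊗ₜ[ℂ] x') = ⟪x, x'⟫_ℂ • y := by
  refine ext_inner_left ℂ fun z => ?_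
  rw [braR, ContinuousLinearMap.adjoint_inner_right, ketR_apply, TensorProduct.inner_tmul,
    inner_smul_right, mul_comm]

lemma inner_braL (x : X) (y : Y) (u : tensor X Y) : ⟪y, braL x Y u⟫_ℂ = ⟪x ⊗ₜ[ℂ] y, u⟫_ℂ := by
  rw [braL, ContinuousLinearMap.adjoint_inner_right, ketL_apply]

lemma inner_braL_left (x : X) (y : Y) (u : tensor X Y) :
    ⟪braL x Y u, y⟫_ℂ = ⟪u, x ⊗ₜ[ℂ] y⟫_ℂ := by
  rw [braL, ContinuousLinearMap.adjoint_inner_left, ketL_apply]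

lemma rTensor_rankOne_apply (x x' : X) (u : tensor X Y) :
    (rankOne ℂ x x').rTensor Y u = x ⊗ₜ[ℂ] braL x' Y u := by
  induction u using TensorProduct.induction_on with
  | zero => simp
  | tmul a b =>
    rw [ContinuousLinearMap.rTensor_tmul, braL_tmul, rankOne_apply, TensorProduct.smul_tmul]
  | add u v hu hv => rw [map_add, map_add, hu, hv, TensorProduct.tmul_add]

lemma inner_rTensor_rankOne (x x' : X) (u v : tensor X Y) :
    ⟪u, (rankOne ℂ x x').rTensor Y v⟫_ℂ = ⟪braL x Y u, braL x' Y v⟫_ℂ := by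
  rw [rTensor_rankOne_apply, inner_braL_left]

lemma sum_tmul_braL {ι : Type*} [Fintype ι] (b : OrthonormalBasis ι ℂ X) (u : tensor X Y) :
    ∑ i, b i ⊗ₜ[ℂ] braL (b i) Y u = u := by
  induction u using TensorProduct.induction_on with
  | zero => simp
  | tmul x y =>
    conv_rhs => rw [← b.sum_repr' x, TensorProduct.sum_tmul]
    refine Finset.sum_congr rfl fun i _ => ?_
    rw [braL_tmul, TensorProduct.smul_tmul]
  | add u v hu hv =>
    conv_rhs => rw [← hu, ← hv, ← Finset.sum_add_distrib]
    refine Finset.sum_congr rfl fun i _ => ?_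
    rw [map_add, TensorProduct.tmul_add]

lemma ext_braL {ι : Type*} [Fintype ι] (b : OrthonormalBasis ι ℂ X) {u v : tensor X Y}
    (h : ∀ i, braL (b i) Y u = braL (b i) Y v) : u = v := by
  rw [← sum_tmul_braL b u, ← sum_tmul_braL b v]
  simp_rw [h]

/-- Used to extract the legs of `supermapDilation`: against an orthonormal basis, the factor `⟪x,
x'⟫` leaves a single term of the cup. -/
lemma braL_mapL (x : X) (x' : X) (y : Y) {Z' : FHilb.{u}} (g : Z →L[ℂ] Z') (u : tensor Y Z) :
    braL (X := tensor X Y) (x ⊗ₜ[ℂ] y) Z' (TensorProduct.mapL (ketL x' Y) g u) =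
      ⟪x, x'⟫_ℂ • g (braL y Z u) := by
  induction u using TensorProduct.induction_on with
  | zero => simp
  | tmul a c =>
    rw [TensorProduct.mapL_tmul, ketL_apply, braL_tmul, braL_tmul, map_smul, smul_smul,
      TensorProduct.inner_tmul]
  | add u v hu hv => simp only [map_add, hu, hv, smul_add]

/-- The partial trace can be computed in any orthonormal basis. -/
lemma inner_ptrace {ι : Type*} [Fintype ι] (b : OrthonormalBasis ι ℂ X)
    (f : tensor X Y →L[ℂ] tensor X Y) (y y' : Y) :
    ⟪y, ptrace f y'⟫_ℂ = ∑ i, ⟪b i ⊗ₜ[ℂ] y, f (b i ⊗ₜ[ℂ] y')⟫_ℂ := by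
  have key : ∀ x x' : X, ⟪x ⊗ₜ[ℂ] y, f (x' ⊗ₜ[ℂ] y')⟫_ℂ =
      ⟪x, (braR y X ∘L f ∘L ketR y' X).toLinearMap x'⟫_ℂ := fun x x' => by
    change _ = ⟪x, braR y X (f (ketR y' X x'))⟫_ℂ
    rw [braR, ContinuousLinearMap.adjoint_inner_right, ketR_apply, ketR_apply]
  simp_rw [key]
  rw [← LinearMap.trace_eq_sum_inner,
    LinearMap.trace_eq_sum_inner _ (stdOrthonormalBasis ℂ X)]
  rw [ptrace, sum_apply, inner_sum]
  refine Finset.sum_congr rfl fun i _ => ?_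
  rw [← key]
  exact inner_braL _ _ _

section Sum

variable {B : Type} [Fintype B] {F : B → FHilb.{u}}

lemma proj_incl_same [DecidableEq B] (b : B) (x : F b) : proj F b (incl F b x) = x :=
  Pi.single_eq_same (M := fun b => F b) b x

lemma proj_incl_of_ne [DecidableEq B] {b b' : B} (h : b ≠ b') (x : F b') :
    proj F b (incl F b' x) = 0 := Pi.single_eq_of_ne (M := fun b => F b) h x

lemma proj_sum_incl [DecidableEq B] (f : ∀ b, F b) (b : B) :
    proj F b (∑ b', incl F b' (f b')) = f b := by
  rw [map_sum, Finset.sum_eq_single b]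
  · exact proj_incl_same b _
  · intro b' _ h
    exact proj_incl_of_ne h.symm _
  · simp

lemma inner_incl [DecidableEq B] (b : B) (x : F b) (v : sum F) :
    ⟪incl F b x, v⟫_ℂ = ⟪x, proj F b v⟫_ℂ := by
  rw [PiLp.inner_apply, Finset.sum_eq_single b]
  · exact congrArg (⟪·, v b⟫_ℂ) (proj_incl_same b x)
  · intro b' _ h
    exact (congrArg (⟪·, v b'⟫_ℂ) (proj_incl_of_ne h x)).trans (inner_zero_left _)
  · simp

lemma ext_proj {u v : sum F} (h : ∀ b, proj F b u = proj F b v) : u = v :=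
  PiLp.ext h

end Sum

end FHilb

/-! ### Stinespring representations in coordinates -/

open FHilb

section Legs

variable {A B : Type} {H : OneMor.{u} Unit A} {K : OneMor.{u} Unit B} {E : OneMor.{u} A B}

lemma rankOne_decomposition {X : FHilb.{u}} {ι : Type*} [Fintype ι] (b : OrthonormalBasis ι ℂ X)
    (f : X →L[ℂ] X) :
    f = ∑ i, ∑ j, ⟪b i, f (b j)⟫_ℂ • InnerProductSpace.rankOne ℂ (b i) (b j) := by
  ext z
  simp only [sum_apply, smul_apply, InnerProductSpace.rankOne_apply]
  rw [Finset.sum_comm]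
  conv_lhs => rw [← b.sum_repr' z, map_sum]
  refine Finset.sum_congr rfl fun j _ => ?_
  rw [map_smul]
  conv_lhs => rw [← b.sum_repr' (f (b j)), Finset.smul_sum]
  refine Finset.sum_congr rfl fun i _ => ?_
  rw [smul_comm]

/-- The operator `|x⟩⟨x'|` in the summand `a` of `End(H)`. -/
def matrixUnit [DecidableEq A] (H : OneMor.{u} Unit A) (a : A) (x x' : H () a) : EndAlg H :=
  fun _ => Pi.single a (InnerProductSpace.rankOne ℂ x x')

lemma matrixUnit_same [DecidableEq A] (a : A) (x x' : H () a) :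
    matrixUnit H a x x' () a = InnerProductSpace.rankOne ℂ x x' := Pi.single_eq_same _ _

lemma matrixUnit_of_ne [DecidableEq A] {a a' : A} (h : a' ≠ a) (x x' : H () a) :
    matrixUnit H a x x' () a' = 0 := Pi.single_eq_of_ne h _

variable [Fintype A]

/-- The vector `(⟨x| ⊗ id) (V y)_a` in the environment. -/
def TwoMor.leg (V : TwoMor K (H.comp E)) (a : A) (b : B) (x : H () a) (y : K () b) : E a b :=
  braL x (E a b) (proj (fun a => tensor (H () a) (E a b)) a (V () b y))

/-- A 2-morphism `K → H ⊗ E` is determined by its legs. -/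
lemma TwoMor.ext_leg {V V' : TwoMor K (H.comp E)} {ι : A → Type*} [∀ a, Fintype (ι a)]
    (e : ∀ a, OrthonormalBasis (ι a) ℂ (H () a))
    (h : ∀ a b i y, V.leg a b (e a i) y = V'.leg a b (e a i) y) : V = V' := by
  funext t b
  ext y : 1
  exact ext_proj fun a => ext_braL (e a) fun i => h a b i y

variable [DecidableEq A]

lemma matrixUnit_decomposition {ι : A → Type*} [∀ a, Fintype (ι a)]
    (e : ∀ a, OrthonormalBasis (ι a) ℂ (H () a)) (x : EndAlg H) :
    x = ∑ a, ∑ i, ∑ j, ⟪e a i, x () a (e a j)⟫_ℂ • matrixUnit H a (e a i) (e a j) := by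
  funext t a
  rw [Finset.sum_apply, Finset.sum_apply, Finset.sum_eq_single a]
  · conv_lhs => rw [rankOne_decomposition (e a) (x t a)]
    simp_rw [Finset.sum_apply, Pi.smul_apply]
    exact Finset.sum_congr rfl fun i _ => Finset.sum_congr rfl fun j _ =>
      congrArg _ (matrixUnit_same a _ _).symm
  · intro a' _ h
    simp_rw [Finset.sum_apply, Pi.smul_apply]
    exact Finset.sum_eq_zero fun i _ => Finset.sum_eq_zero fun j _ =>
      (congrArg _ (matrixUnit_of_ne h.symm _ _)).trans (smul_zero _)
  · simp

lemma proj_whisker (x : EndAlg H) (b : B) (u : (H.comp E) () b) (a : A) :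
    proj (fun a => tensor (H () a) (E a b)) a (TwoMor.whisker x E () b u) =
      (x () a).rTensor (E a b) (proj (fun a => tensor (H () a) (E a b)) a u) := by
  simp only [TwoMor.whisker, sum_apply, ContinuousLinearMap.comp_apply]
  exact proj_sum_incl (F := fun a => tensor (H () a) (E a b))
    (fun a => (x () a).rTensor (E a b) (proj (fun a => tensor (H () a) (E a b)) a u)) a

lemma inner_dilation (V : TwoMor K (H.comp E)) (x : EndAlg H) (b : B) (y y' : K () b) :
    ⟪y, V.dagger.comp ((TwoMor.whisker x E).comp V) () b y'⟫_ℂ =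
      ∑ a, ⟪proj (fun a => tensor (H () a) (E a b)) a (V () b y),
        (x () a).rTensor (E a b) (proj (fun a => tensor (H () a) (E a b)) a (V () b y'))⟫_ℂ := by
  simp only [TwoMor.comp, TwoMor.dagger, ContinuousLinearMap.comp_apply,
    ContinuousLinearMap.adjoint_inner_right]
  rw [PiLp.inner_apply]
  exact Finset.sum_congr rfl fun a _ => congrArg _ (proj_whisker x b (V () b y') a)

/-- Since `End(H)` is spanned by matrix units, this reduces the Stinespring equation to a
prescription of the Gram matrix of the legs. -/
lemma inner_dilation_matrixUnit (V : TwoMor K (H.comp E)) (a : A) (x x' : H () a) (b : B)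
    (y y' : K () b) :
    ⟪y, V.dagger.comp ((TwoMor.whisker (matrixUnit H a x x') E).comp V) () b y'⟫_ℂ =
      ⟪V.leg a b x y, V.leg a b x' y'⟫_ℂ := by
  rw [inner_dilation, Finset.sum_eq_single a]
  · rw [matrixUnit_same, inner_rTensor_rankOne]
    rfl
  · intro a' _ h
    rw [matrixUnit_of_ne h, ContinuousLinearMap.rTensor_zero, zero_apply,
      inner_zero_right]
  · simp

/-- The legs in an orthonormal basis can be prescribed. -/
lemma TwoMor.exists_leg_eq {ι : A → Type*} [∀ a, Fintype (ι a)]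
    (e : ∀ a, OrthonormalBasis (ι a) ℂ (H () a)) (T : ∀ a b, ι a → K () b →L[ℂ] E a b) :
    ∃ V : TwoMor K (H.comp E), ∀ a b i y, V.leg a b (e a i) y = T a b i y := by
  refine ⟨fun _ b => ∑ a, incl (fun a => tensor (H () a) (E a b)) a ∘L
    ∑ i, ketL (e a i) (E a b) ∘L T a b i, fun a b i y => ?_⟩
  simp only [TwoMor.leg, sum_apply, ContinuousLinearMap.comp_apply]
  have h := proj_sum_incl (F := fun a => tensor (H () a) (E a b))
    (fun a => ∑ i, ketL (e a i) (E a b) (T a b i y)) a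
  rw [h, map_sum, Finset.sum_eq_single i]
  · rw [ketL_apply, braL_tmul, inner_self_eq_norm_sq_to_K, (e a).norm_eq_one]
    simp
  · intro j _ hj
    rw [ketL_apply, braL_tmul, (e a).inner_eq_zero hj.symm, zero_smul]
  · simp

lemma inner_envGram (V : TwoMor K (H.comp E)) (a : A) (b : B) (v w : E a b) :
    ⟪v, envGram E V a b w⟫_ℂ = ∑ i, ⟪(V () b).adjoint (incl (fun a => tensor (H () a) (E a b)) a
        (stdOrthonormalBasis ℂ (H () a) i ⊗ₜ[ℂ] v)),
      (V () b).adjoint (incl (fun a => tensor (H () a) (E a b)) a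
        (stdOrthonormalBasis ℂ (H () a) i ⊗ₜ[ℂ] w))⟫_ℂ := by
  rw [envGram, inner_ptrace (stdOrthonormalBasis ℂ (H () a))]
  refine Finset.sum_congr rfl fun i _ => ?_
  rw [ContinuousLinearMap.adjoint_inner_left, inner_incl]
  rfl

/-- If the legs of `V` span the environment, then `envGram E V` is invertible. -/
lemma exists_inverse_envGram (V : TwoMor K (H.comp E))
    (hV : ∀ a b, Submodule.span ℂ (Set.range fun p : H () a × K () b => V.leg a b p.1 p.2) = ⊤) :
    ∃ g : TwoMor E E,
      g.comp (envGram E V) = TwoMor.id E ∧ (envGram E V).comp g = TwoMor.id E := by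
  have inj : ∀ a b, Function.Injective (envGram E V a b).toLinearMap := by
    intro a b
    rw [← LinearMap.ker_eq_bot, LinearMap.ker_eq_bot']
    intro w hw
    have h0 : ⟪w, envGram E V a b w⟫_ℂ = 0 := by
      rw [show envGram E V a b w = 0 from hw, inner_zero_right]
    rw [inner_envGram] at h0
    have h1 : ∀ i, (V () b).adjoint (incl (fun a => tensor (H () a) (E a b)) a
        (stdOrthonormalBasis ℂ (H () a) i ⊗ₜ[ℂ] w)) = 0 := by
      simp only [inner_self_eq_norm_sq_to_K] at h0
      intro i
      have h2 : ∑ i, ‖(V () b).adjoint (incl (fun a => tensor (H () a) (E a b)) a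
        (stdOrthonormalBasis ℂ (H () a) i ⊗ₜ[ℂ] w))‖ ^ 2 = 0 := by
        exact Complex.ofReal_injective (by push_cast; exact h0)
      rw [Finset.sum_eq_zero_iff_of_nonneg (fun _ _ => by positivity)] at h2
      exact norm_eq_zero.mp (pow_eq_zero_iff two_ne_zero |>.mp (h2 i (Finset.mem_univ i)))
    -- The quadratic form of `envGram` at `w` is a sum of squared norms `‖V†(e_i ⊗ w)‖²`, so a
    -- kernel vector is orthogonal to every leg, hence to their span, which is everything.
    have h3 : ∀ (x : H () a) (y : K () b), ⟪V.leg a b x y, w⟫_ℂ = 0 := by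
      intro x y
      rw [inner_eq_zero_symm, TwoMor.leg, inner_braL]
      refine (inner_incl (F := fun a => tensor (H () a) (E a b)) a (x ⊗ₜ[ℂ] w) _).symm.trans ?_
      rw [← ContinuousLinearMap.adjoint_inner_left]
      have : (V () b).adjoint (incl (fun a => tensor (H () a) (E a b)) a (x ⊗ₜ[ℂ] w)) = 0 := by
        conv_lhs => rw [← (stdOrthonormalBasis ℂ (H () a)).sum_repr' x]
        simp only [TensorProduct.sum_tmul, map_sum, ← TensorProduct.smul_tmul', map_smul, h1,
          smul_zero, Finset.sum_const_zero]
      rw [this, inner_zero_left]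
    have h4 : ∀ z ∈ Submodule.span ℂ
        (Set.range fun p : H () a × K () b => V.leg a b p.1 p.2), ⟪z, w⟫_ℂ = 0 := by
      intro z hz
      induction hz using Submodule.span_induction with
      | mem z hz =>
        obtain ⟨p, rfl⟩ := hz
        exact h3 p.1 p.2
      | zero => exact inner_zero_left _
      | add x y _ _ hx hy => rw [inner_add_left, hx, hy, add_zero]
      | smul c x _ hx => rw [inner_smul_left, hx, mul_zero]
    rw [hV a b] at h4
    exact inner_self_eq_zero.mp (h4 w trivial)
  let e : ∀ a b, E a b ≃ₗ[ℂ] E a b := fun a b =>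
    LinearEquiv.ofInjectiveEndo (envGram E V a b).toLinearMap (inj a b)
  refine ⟨fun a b => LinearMap.toContinuousLinearMap (e a b).symm.toLinearMap, ?_, ?_⟩
  · funext a b
    ext w
    exact (e a b).symm_apply_apply w
  · funext a b
    ext w
    exact (e a b).apply_symm_apply w

variable [Fintype B]

lemma IsStinespring.inner_matrixUnit {F : EndAlg H →CP EndAlg K} {V : TwoMor K (H.comp E)}
    (h : IsStinespring F E V) (a : A) (x x' : H () a) (b : B) (y y' : K () b) :
    ⟪y, F (matrixUnit H a x x') () b y'⟫_ℂ = ⟪V.leg a b x y, V.leg a b x' y'⟫_ℂ := by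
  rw [h, inner_dilation_matrixUnit]

/-- A Stinespring representation can be recognised on matrix units. -/
lemma isStinespring_of_inner_matrixUnit {F : EndAlg H →CP EndAlg K} {V : TwoMor K (H.comp E)}
    {ι : A → Type*} [∀ a, Fintype (ι a)] (e : ∀ a, OrthonormalBasis (ι a) ℂ (H () a))
    (h : ∀ a i j b (y y' : K () b), ⟪y, F (matrixUnit H a (e a i) (e a j)) () b y'⟫_ℂ =
      ⟪V.leg a b (e a i) y, V.leg a b (e a j) y'⟫_ℂ) : IsStinespring F E V := by
  intro x
  funext t b
  ext y'
  refine ext_inner_left ℂ fun y => ?_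
  -- Both sides of the Stinespring equation are linear in `x`, so for fixed `y`, `y'` they are
  -- compared as functionals on the matrix units.
  let G : EndAlg H →ₗ[ℂ] ℂ :=
    { toFun := fun x => ⟪y, V.dagger.comp ((TwoMor.whisker x E).comp V) () b y'⟫_ℂ
      map_add' := fun x x' => by
        simp only [inner_dilation, Pi.add_apply, ContinuousLinearMap.rTensor_add,
          add_apply, inner_add_right, Finset.sum_add_distrib]
      map_smul' := fun c x => by
        simp only [inner_dilation, Pi.smul_apply, ContinuousLinearMap.rTensor_smul,
          smul_apply, Finset.mul_sum, smul_eq_mul, RingHom.id_apply]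
        exact Finset.sum_congr rfl fun a _ =>
          inner_smul_right (E := tensor (H () a) (E a b)) _ _ _ }
  let G' : EndAlg H →ₗ[ℂ] ℂ :=
    { toFun := fun x => ⟪y, F x () b y'⟫_ℂ
      map_add' := fun x x' => by
        rw [map_add, Pi.add_apply, Pi.add_apply, add_apply, inner_add_right]
      map_smul' := fun c x => by
        rw [map_smul, Pi.smul_apply, Pi.smul_apply, smul_apply,
          inner_smul_right, smul_eq_mul, RingHom.id_apply] }
  change G' x = G x
  rw [matrixUnit_decomposition e x]
  simp only [map_sum, map_smul]
  refine Finset.sum_congr rfl fun a _ => Finset.sum_congr rfl fun i _ =>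
    Finset.sum_congr rfl fun j _ => congrArg _ ?_
  change ⟪y, F _ () b y'⟫_ℂ = ⟪y, V.dagger.comp ((TwoMor.whisker _ E).comp V) () b y'⟫_ℂ
  rw [h, inner_dilation_matrixUnit]

end Legs

end TwoFHilb

/-! ### Completely positive maps and Gram decompositions -/

lemma CStarAlgebra.exists_eq_star_mul_self {A : Type*} [NonUnitalCStarAlgebra A] [PartialOrder A]
    [StarOrderedRing A] {a : A} (ha : 0 ≤ a) : ∃ b, a = star b * b :=
  CStarAlgebra.nonneg_iff_eq_star_mul_self.mp ha

namespace CompletelyPositiveMap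

variable {A₁ A₂ A₃ : Type*} [CStarAlgebra A₁] [CStarAlgebra A₂] [CStarAlgebra A₃]
  [PartialOrder A₁] [PartialOrder A₂] [PartialOrder A₃]
  [StarOrderedRing A₁] [StarOrderedRing A₂] [StarOrderedRing A₃]

/-- The composition of completely positive maps. -/
def comp (ψ : A₂ →CP A₃) (φ : A₁ →CP A₂) : A₁ →CP A₃ where
  toLinearMap := ψ.toLinearMap ∘ₗ φ.toLinearMap
  map_cstarMatrix_nonneg' k M hM :=
    ψ.map_cstarMatrix_nonneg' k _ (φ.map_cstarMatrix_nonneg' k M hM)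

lemma comp_apply (ψ : A₂ →CP A₃) (φ : A₁ →CP A₂) (x : A₁) : ψ.comp φ x = ψ (φ x) := rfl

/-- A linear map is completely positive if `φ (x* y) = ∑ t, (L t x)* (L t y)`. -/
def ofGram {τ : Type*} [Fintype τ] (φ : A₁ →ₗ[ℂ] A₂) (L : τ → A₁ → A₂)
    (h : ∀ x y, φ (star x * y) = ∑ t, star (L t x) * L t y) : A₁ →CP A₂ where
  toLinearMap := φ
  map_cstarMatrix_nonneg' k M hM := by
    obtain ⟨Y, rfl⟩ := CStarAlgebra.exists_eq_star_mul_self hM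
    -- No linearity of `L t` is needed: it is only applied entrywise to `Y`.
    have key : (star Y * Y).map φ = ∑ t, star (Y.map (L t)) * Y.map (L t) := by
      ext i j
      have hsum : (∑ t, star (Y.map (L t)) * Y.map (L t)) i j =
          ∑ t, (star (Y.map (L t)) * Y.map (L t)) i j :=
        Matrix.sum_apply i j Finset.univ fun t => star (Y.map (L t)) * Y.map (L t)
      rw [hsum, CStarMatrix.map_apply, CStarMatrix.mul_apply, map_sum]
      simp_rw [CStarMatrix.mul_apply, CStarMatrix.star_apply, CStarMatrix.map_apply, h]
      exact Finset.sum_comm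
    rw [key]
    exact Finset.sum_nonneg fun t _ => star_mul_self_nonneg _

/-- A completely positive map sends Gram matrices to Gram matrices. -/
lemma exists_gram (φ : A₁ →CP A₂) {ι : Type*} [Fintype ι] (x : ι → A₁) :
    ∃ Z : ι → ι → A₂, ∀ i j, φ (star (x i) * x j) = ∑ r, star (Z r i) * Z r j := by
  classical
  rcases isEmpty_or_nonempty ι with _ | ⟨⟨o⟩⟩
  · exact ⟨fun i => isEmptyElim i, fun i => isEmptyElim i⟩
  -- The family is placed in the single row `o` of a square matrix, so that `star Y * Y` is its Gram
  -- matrix and complete positivity applies.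
  let Y : CStarMatrix ι ι A₁ := CStarMatrix.ofMatrix fun r i => if r = o then x i else 0
  have hY : ∀ i j, (star Y * Y) i j = star (x i) * x j := fun i j => by
    have hYr : ∀ r i, Y r i = if r = o then x i else 0 := fun r i => rfl
    simp [CStarMatrix.mul_apply, CStarMatrix.star_apply, hYr]
  obtain ⟨Z, hZ⟩ := CStarAlgebra.exists_eq_star_mul_self
    (φ.map_cstarMatrix_nonneg (star Y * Y) (star_mul_self_nonneg Y))
  refine ⟨fun r i => Z r i, fun i j => ?_⟩
  rw [← hY, ← CStarMatrix.map_apply (M := star Y * Y) (f := φ), hZ, CStarMatrix.mul_apply]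
  simp_rw [CStarMatrix.star_apply]

end CompletelyPositiveMap

namespace TwoFHilb

open FHilb

/-! ### Existence of Stinespring representations with spanning legs -/

section Existence

variable {A B : Type} [DecidableEq A] {H : OneMor.{u} Unit A} {K : OneMor.{u} Unit B}

/-- Exhibits the matrix units as a Gram matrix, so that `CompletelyPositiveMap.exists_gram` applies
to them. -/
lemma star_matrixUnit_mul (a : A) (o x x' : H () a) (ho : ‖o‖ = 1) :
    star (matrixUnit H a o x) * matrixUnit H a o x' = matrixUnit H a x x' := by
  funext t a'
  change star (matrixUnit H a o x () a') * matrixUnit H a o x' () a' = matrixUnit H a x x' () a'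
  by_cases h : a' = a
  · subst h
    rw [matrixUnit_same, matrixUnit_same, matrixUnit_same, ContinuousLinearMap.star_eq_adjoint,
      InnerProductSpace.adjoint_rankOne]
    ext z
    rw [mul_apply_eq_comp]
    simp [InnerProductSpace.rankOne_apply, inner_self_eq_norm_sq_to_K, ho]
  · rw [matrixUnit_of_ne h, matrixUnit_of_ne h, matrixUnit_of_ne h, mul_zero]

variable [Fintype A] [Fintype B]

/-- Complete positivity factors the matrix of values of `F` on matrix units as `∑ r, star (Z r i) *
Z r j`. Stacking the operators `Z r i` over `r` gives vectors with the required inner products. -/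
lemma exists_legs (F : EndAlg H →CP EndAlg K) (a : A) (b : B) {ι : Type} [Fintype ι]
    (e : OrthonormalBasis ι ℂ (H () a)) :
    ∃ (X : FHilb.{u}) (T : ι → K () b →L[ℂ] X),
      (∀ i j y y', ⟪y, F (matrixUnit H a (e i) (e j)) () b y'⟫_ℂ = ⟪T i y, T j y'⟫_ℂ) ∧
      Submodule.span ℂ (Set.range fun p : ι × K () b => T p.1 p.2) = ⊤ := by
  obtain ⟨Z, hZ⟩ : ∃ Z : ι → ι → EndAlg K, ∀ i j, F (matrixUnit H a (e i) (e j)) =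
      ∑ r, star (Z r i) * Z r j := by
    rcases isEmpty_or_nonempty ι with _ | ⟨⟨o⟩⟩
    · exact ⟨fun i => isEmptyElim i, fun i => isEmptyElim i⟩
    obtain ⟨Z, hZ⟩ := F.exists_gram fun i => matrixUnit H a (e o) (e i)
    refine ⟨Z, fun i j => ?_⟩
    rw [← hZ, star_matrixUnit_mul _ _ _ _ (e.norm_eq_one o)]
  let T : ι → K () b →ₗ[ℂ] PiLp 2 fun _ : ι => K () b := fun j =>
    (WithLp.linearEquiv 2 ℂ (ι → K () b)).symm.toLinearMap ∘ₗ
      LinearMap.pi fun r => (Z r j () b).toLinearMap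
  -- Restricting the environment to the span of the vectors changes no inner product and is what
  -- will make the representation minimal.
  let U : Submodule ℂ (PiLp 2 fun _ : ι => K () b) :=
    Submodule.span ℂ (Set.range fun p : ι × K () b => T p.1 p.2)
  have hU : ∀ i y, T i y ∈ U := fun i y => Submodule.subset_span ⟨(i, y), rfl⟩
  refine ⟨⟨U⟩, fun i => LinearMap.toContinuousLinearMap ((T i).codRestrict U (hU i)),
    fun i j y y' => ?_, ?_⟩
  · change _ = ⟪T i y, T j y'⟫_ℂ
    rw [hZ, PiLp.inner_apply, Finset.sum_apply, Finset.sum_apply, sum_apply, inner_sum]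
    exact Finset.sum_congr rfl fun r _ =>
      ContinuousLinearMap.adjoint_inner_right (Z r i () b) y (Z r j () b y')
  · have h := Submodule.span_span_coe_preimage (R := ℂ)
      (s := Set.range fun p : ι × K () b => T p.1 p.2)
    refine Eq.trans (congrArg _ (Set.ext fun z => ?_)) h
    constructor
    · rintro ⟨p, rfl⟩
      exact ⟨p, rfl⟩
    · rintro ⟨p, hp⟩
      exact ⟨p, Subtype.ext hp⟩

/-- Every completely positive map has a Stinespring representation whose legs span the
environment. -/
lemma exists_stinespring (F : EndAlg H →CP EndAlg K) :
    ∃ (E : OneMor.{u} A B) (V : TwoMor K (H.comp E)), IsStinespring F E V ∧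
      ∀ a b, Submodule.span ℂ
        (Set.range fun p : H () a × K () b => V.leg a b p.1 p.2) = ⊤ := by
  choose E T hT hspan using fun a b => exists_legs F a b (stdOrthonormalBasis ℂ (H () a))
  obtain ⟨V, hV⟩ := TwoMor.exists_leg_eq (K := K) (E := E)
    (fun a => stdOrthonormalBasis ℂ (H () a)) T
  refine ⟨E, V, isStinespring_of_inner_matrixUnit (fun a => stdOrthonormalBasis ℂ (H () a))
    fun a i j b y y' => ?_, fun a b => ?_⟩
  · rw [hT, hV, hV]
  · rw [eq_top_iff, ← hspan a b]
    refine Submodule.span_mono ?_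
    rintro _ ⟨⟨i, y⟩, rfl⟩
    exact ⟨(stdOrthonormalBasis ℂ (H () a) i, y), hV a b i y⟩

end Existence

/-! ### Partial traces -/

section PartialTrace

variable {m n : Type} {H : OneMor.{u} Unit n} {P : OneMor.{u} Unit m}

lemma EndAlg.ext_inner {x x' : EndAlg P}
    (h : ∀ i (y y' : P () i), ⟪y, x () i y'⟫_ℂ = ⟪y, x' () i y'⟫_ℂ) : x = x' := by
  funext t i
  ext y'
  exact ext_inner_left ℂ fun y => h i y y'

variable (H P) in
/-- The embedding `y ↦ id_H ⊠ y`. -/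
def amplify : EndAlg P →⋆ₙₐ[ℂ] EndAlg (H.box₁ P) where
  toFun y := fun _ p => (y () p.2).lTensor (H () p.1)
  map_smul' c y := by
    funext t p
    exact ContinuousLinearMap.lTensor_smul _ _ _
  map_zero' := by
    funext t p
    exact ContinuousLinearMap.lTensor_zero _
  map_add' y y' := by
    funext t p
    exact ContinuousLinearMap.lTensor_add _ _ _
  map_mul' y y' := by
    funext t p
    exact ContinuousLinearMap.lTensor_mul _ _ _
  map_star' y := by
    funext t p
    exact (ContinuousLinearMap.adjoint_lTensor _ _).symm

lemma amplify_one : amplify H P 1 = 1 := by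
  funext t p
  exact ContinuousLinearMap.lTensor_one _

variable [Fintype n]

lemma inner_trOut (b : Bases H) (x : EndAlg (H.box₁ P)) (i : m) (y y' : P () i) :
    ⟪y, trOut H P x () i y'⟫_ℂ =
      ∑ j, ∑ a, ⟪b j a ⊗ₜ[ℂ] y, x () (j, i) (b j a ⊗ₜ[ℂ] y')⟫_ℂ := by
  rw [trOut, sum_apply, inner_sum]
  exact Finset.sum_congr rfl fun j _ => inner_ptrace (b j) _ y y'

variable (H P) in
/-- The partial trace as a linear map. -/
def trOutₗ : EndAlg (H.box₁ P) →ₗ[ℂ] EndAlg P where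
  toFun := trOut H P
  map_add' x x' := by
    let b : Bases H := fun j => stdOrthonormalBasis ℂ (H () j)
    refine EndAlg.ext_inner fun i y y' => ?_
    rw [Pi.add_apply, Pi.add_apply, add_apply, inner_add_right, inner_trOut b, inner_trOut b,
      inner_trOut b]
    simp_rw [← Finset.sum_add_distrib]
    exact Finset.sum_congr rfl fun j _ => Finset.sum_congr rfl fun a _ => inner_add_right _ _ _
  map_smul' c x := by
    let b : Bases H := fun j => stdOrthonormalBasis ℂ (H () j)
    refine EndAlg.ext_inner fun i y y' => ?_
    rw [Pi.smul_apply, Pi.smul_apply, smul_apply, inner_smul_right, inner_trOut b, inner_trOut b]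
    simp_rw [Finset.mul_sum]
    exact Finset.sum_congr rfl fun j _ => Finset.sum_congr rfl fun a _ =>
      inner_smul_right (E := tensor (H () j) (P () i)) _ _ _

lemma trOutₗ_apply (x : EndAlg (H.box₁ P)) : trOutₗ H P x = trOut H P x := rfl

lemma trOut_star (x : EndAlg (H.box₁ P)) : trOut H P (star x) = star (trOut H P x) := by
  let b : Bases H := fun j => stdOrthonormalBasis ℂ (H () j)
  refine EndAlg.ext_inner fun i y y' => ?_
  have h : ⟪y, star (trOut H P x) () i y'⟫_ℂ = ⟪trOut H P x () i y, y'⟫_ℂ :=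
    ContinuousLinearMap.adjoint_inner_right _ _ _
  rw [h, ← inner_conj_symm (trOut H P x () i y), inner_trOut b, inner_trOut b]
  simp_rw [map_sum]
  refine Finset.sum_congr rfl fun j _ => Finset.sum_congr rfl fun a _ => ?_
  exact (ContinuousLinearMap.adjoint_inner_right (x () (j, i)) _ _).trans
    (inner_conj_symm _ _).symm

lemma inner_eq_sum_braL {X Y : FHilb.{u}} {ι : Type*} [Fintype ι] (b : OrthonormalBasis ι ℂ X)
    (u v : tensor X Y) : ⟪u, v⟫_ℂ = ∑ i, ⟪braL (b i) Y u, braL (b i) Y v⟫_ℂ := by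
  conv_lhs => rw [← sum_tmul_braL b v]
  rw [inner_sum]
  exact Finset.sum_congr rfl fun i _ => (inner_braL_left _ _ _).symm

/-- Up to the total dimension of `H`, `amplify` is a section of the partial trace; this provides the
reduced map when that dimension is nonzero. -/
lemma trOut_amplify (y : EndAlg P) :
    trOut H P (amplify H P y) = ((∑ j, Module.finrank ℂ (H () j) : ℕ) : ℂ) • y := by
  let b : Bases H := fun j => stdOrthonormalBasis ℂ (H () j)
  refine EndAlg.ext_inner fun i z z' => ?_
  rw [inner_trOut b, Pi.smul_apply, Pi.smul_apply, smul_apply, inner_smul_right, Nat.cast_sum,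
    Finset.sum_mul]
  refine Finset.sum_congr rfl fun j _ => ?_
  have h : ∀ a, ⟪b j a ⊗ₜ[ℂ] z, amplify H P y () (j, i) (b j a ⊗ₜ[ℂ] z')⟫_ℂ =
      ⟪z, y () i z'⟫_ℂ := fun a => by
    change ⟪b j a ⊗ₜ[ℂ] z, b j a ⊗ₜ[ℂ] y () i z'⟫_ℂ = _
    rw [TensorProduct.inner_tmul, inner_self_eq_norm_sq_to_K, (b j).norm_eq_one]
    simp
  rw [Finset.sum_congr rfl fun a _ => h a]
  simp

variable [Fintype m]

variable (H P) in
/-- The partial trace as a completely positive map. -/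
def trOutCP : EndAlg (H.box₁ P) →CP EndAlg P :=
  CompletelyPositiveMap.ofGram (trOutₗ H P)
    (τ := Σ j, Fin (Module.finrank ℂ (H () j)) × Fin (Module.finrank ℂ (H () j)))
    (fun t x _ i => braL (stdOrthonormalBasis ℂ (H () t.1) t.2.1) (P () i) ∘L x () (t.1, i) ∘L
      ketL (stdOrthonormalBasis ℂ (H () t.1) t.2.2) (P () i)) fun x x' => by
    let b : Bases H := fun j => stdOrthonormalBasis ℂ (H () j)
    refine EndAlg.ext_inner fun i y y' => ?_
    rw [trOutₗ_apply, inner_trOut b, Finset.sum_apply, Finset.sum_apply, sum_apply, inner_sum,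
      Fintype.sum_sigma]
    -- Inserting a resolution of the identity of `H` between `star x` and `x'` turns the trace into
    -- a sum over pairs of basis vectors, one for the trace and one for the resolution.
    refine Finset.sum_congr rfl fun j _ => ?_
    rw [Fintype.sum_prod_type, Finset.sum_comm]
    refine Finset.sum_congr rfl fun a _ => ?_
    refine (ContinuousLinearMap.adjoint_inner_right (x () (j, i)) _ _).trans ?_
    rw [inner_eq_sum_braL (b j)]
    exact Finset.sum_congr rfl fun a' _ =>
      (ContinuousLinearMap.adjoint_inner_right
        (braL (b j a') (P () i) ∘L x () (j, i) ∘L ketL (b j a) (P () i)) y _).symm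

end PartialTrace

end TwoFHilb

/-! ### Unital maps induced by normalized maps -/

/-- The positive elements with `T x = 1` contain a neighbourhood of `d⁻¹ • 1` in the self-adjoint
part of their affine hull. A map constant on them kills all self-adjoint directions in `ker T`, and
hence `ker T`, which is closed under `star`. -/
lemma map_eq_zero_of_normalized {A A' B : Type*} [CStarAlgebra A] [CStarAlgebra A']
    [CStarAlgebra B] [PartialOrder A] [StarOrderedRing A] {d : ℕ} (hd : d ≠ 0)
    {T : A →ₗ[ℂ] A'} (hT1 : T 1 = (d : ℂ) • 1)
    (hTs : ∀ x, T (star x) = star (T x)) {R : A →ₗ[ℂ] B}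
    (hR : ∀ x, 0 ≤ x → T x = 1 → R x = 1) {x : A} (hx : T x = 0) : R x = 0 := by
  have hd0 : (d : ℂ) ≠ 0 := by exact_mod_cast hd
  have hself : ∀ y : A, IsSelfAdjoint y → T y = 0 → R y = 0 := by
    intro y hy hy0
    -- Normalizing `c • 1 + z` by `c * d` makes it admissible for `hR`. The resulting identity is
    -- used for `z = y` and for `z = 0`, and the two are compared.
    have main : ∀ c : ℝ, 0 < c → ∀ z : A, 0 ≤ c • 1 + z → T z = 0 →
        R 1 + (c : ℂ)⁻¹ • R z = (d : ℂ) • 1 := by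
      intro c hc z hz hz0
      have hc0 : (c : ℂ) ≠ 0 := by exact_mod_cast hc.ne'
      have h1 : R (((c : ℂ) * d)⁻¹ • ((c : ℂ) • 1 + z)) = 1 := by
        refine hR _ ?_ ?_
        · have : ((c : ℂ) * d)⁻¹ • ((c : ℂ) • 1 + z) = (c * d)⁻¹ • (c • 1 + z) := by
            rw [← Complex.coe_smul, ← Complex.coe_smul]
            push_cast
            rfl
          rw [this]
          exact smul_nonneg (by positivity) hz
        · rw [map_smul, map_add, map_smul, hT1, hz0, add_zero, smul_smul,
            smul_smul, mul_assoc, inv_mul_cancel₀ (mul_ne_zero hc0 hd0), one_smul]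
      rw [map_smul, map_add, map_smul, inv_smul_eq_iff₀ (mul_ne_zero hc0 hd0)] at h1
      have h2 := congrArg (fun w => (c : ℂ)⁻¹ • w) h1
      simpa only [smul_add, smul_smul, inv_mul_cancel₀ hc0, inv_mul_cancel_left₀ hc0,
        one_smul] using h2
    -- The norm alone would make `c • 1 + y` positive; the extra `1` keeps `c` nonzero when `y = 0`.
    have hc : 0 < ‖y‖ + 1 := by positivity
    have hpos : 0 ≤ (‖y‖ + 1) • 1 + y := by
      have h1 := hy.neg_algebraMap_norm_le_self
      rw [Algebra.algebraMap_eq_smul_one, neg_le_iff_add_nonneg, add_comm] at h1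
      rw [add_smul, one_smul, add_right_comm]
      exact add_nonneg h1 zero_le_one
    have e1 := main _ hc y hpos hy0
    have e2 := main 1 one_pos 0 (by rw [add_zero, one_smul]; exact zero_le_one) (map_zero _)
    rw [map_zero, smul_zero, add_zero] at e2
    rw [e2, add_eq_left, smul_eq_zero] at e1
    exact e1.resolve_left (inv_ne_zero (by exact_mod_cast hc.ne'))
  have hxs : T (star x) = 0 := by rw [hTs, hx, star_zero]
  have h1 := hself (x + star x) (IsSelfAdjoint.add_star_self x) (by rw [map_add, hx, hxs, add_zero])
  have h2 := hself (Complex.I • (x - star x))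
    (by
      rw [IsSelfAdjoint, star_smul, star_sub, star_star, Complex.star_def, Complex.conj_I, neg_smul,
        ← smul_neg, neg_sub])
    (by rw [map_smul, map_sub, hx, hxs, sub_zero, smul_zero])
  rw [map_smul, smul_eq_zero] at h2
  replace h2 := h2.resolve_left Complex.I_ne_zero
  have h3 : (2 : ℂ) • R x = 0 := by
    have : (2 : ℂ) • x = (x + star x) + (x - star x) := by
      rw [two_smul]
      abel
    rw [← map_smul, this, map_add, h1, h2, add_zero]
  exact (smul_eq_zero.mp h3).resolve_left two_ne_zero

section Abstract

variable {A A' B : Type*} [CStarAlgebra A] [CStarAlgebra A'] [CStarAlgebra B]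
  [PartialOrder A] [PartialOrder A'] [PartialOrder B]
  [StarOrderedRing A] [StarOrderedRing A'] [StarOrderedRing B]

/-- The completely positive map `y ↦ φ y • 1`, where `φ` is a vector functional. -/
def CompletelyPositiveMap.ofFunctional {τ : Type*} [Fintype τ] (φ : A →ₗ[ℂ] ℂ) (f : τ → A → ℂ)
    (h : ∀ x y, φ (star x * y) = ∑ t, star (f t x) * f t y) : A →CP B :=
  CompletelyPositiveMap.ofGram (φ.smulRight 1) (fun t y => f t y • 1) fun x y => by
    rw [LinearMap.smulRight_apply, h, Finset.sum_smul]
    refine Finset.sum_congr rfl fun t _ => ?_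
    rw [star_smul, star_one, smul_mul_smul_comm, mul_one]

/-- `ω = d⁻¹ • α` is a completely positive section of `T`, so `R.comp ω` is the only candidate. It
works because `x - ω (T x)` lies in `ker T`, which `R` annihilates. -/
lemma CompletelyPositiveMap.exists_factorization {d : ℕ} (hd : d ≠ 0) {T : A →ₗ[ℂ] A'}
    (hTs : ∀ x, T (star x) = star (T x)) (α : A' →⋆ₙₐ[ℂ] A) (hα : α 1 = 1)
    (hT : ∀ y, T (α y) = (d : ℂ) • y) (R : A →CP B)
    (hR : ∀ x, 0 ≤ x → T x = 1 → R x = 1) :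
    ∃ 𝒩 : A' →CP B, 𝒩 1 = 1 ∧ ∀ x, R x = 𝒩 (T x) := by
  have hd0 : (d : ℂ) ≠ 0 := by exact_mod_cast hd
  -- The inverse square root of `d`, splitting the factor `d⁻¹` of `ω` evenly between the two sides
  -- of its Gram form.
  let r : ℂ := ((√(d : ℝ))⁻¹ : ℝ)
  have hr : star r * r = (d : ℂ)⁻¹ := by
    have hr' : (√(d : ℝ))⁻¹ * (√(d : ℝ))⁻¹ = (d : ℝ)⁻¹ := by
      rw [← mul_inv, Real.mul_self_sqrt (Nat.cast_nonneg d)]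
    have : star r * r = (((√(d : ℝ))⁻¹ * (√(d : ℝ))⁻¹ : ℝ) : ℂ) := by
      rw [Complex.star_def, Complex.conj_ofReal, Complex.ofReal_mul]
    rw [this, hr']
    push_cast
    rfl
  let α' : A' →ₗ[ℂ] A := { toFun := α, map_add' := map_add α, map_smul' := map_smul α }
  let ω : A' →CP A := CompletelyPositiveMap.ofGram (τ := Unit) ((d : ℂ)⁻¹ • α')
    (fun _ y => r • α y) fun x y => by
      rw [Fintype.sum_unique, star_smul, smul_mul_smul_comm, hr, ← map_star, ← map_mul]
      rfl
  have hω' : ∀ y, ω y = (d : ℂ)⁻¹ • α y := fun y => rfl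
  have hω : ∀ y, T (ω y) = y := fun y => by
    rw [hω', map_smul, hT, smul_smul, inv_mul_cancel₀ hd0, one_smul]
  refine ⟨R.comp ω, ?_, fun x => ?_⟩
  · refine hR _ ?_ (hω 1)
    exact (map_zero ω).symm.le.trans (OrderHomClass.mono ω zero_le_one)
  · rw [CompletelyPositiveMap.comp_apply, ← sub_eq_zero, ← map_sub]
    refine map_eq_zero_of_normalized hd (R := R.toLinearMap) ?_ hTs hR ?_
    · rw [← hα, hT]
    · rw [map_sub, hω, sub_self]

end Abstract

namespace TwoFHilb

open FHilb

/-! ### The reduced map of a deterministic supermap -/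

section Reduction

variable {m n m' n' : Type} {H : OneMor.{u} Unit n} {P : OneMor.{u} Unit m}
  {K : OneMor.{u} Unit n'} {Q : OneMor.{u} Unit m'}

lemma inner_star_mul (x y : EndAlg P) (i : m) (p p' : P () i) :
    ⟪p, (star x * y) () i p'⟫_ℂ = ⟪x () i p, y () i p'⟫_ℂ :=
  ContinuousLinearMap.adjoint_inner_right (x () i) p (y () i p')

variable [Fintype m] [Fintype m']

variable (Q) in
/-- The completely positive map `y ↦ ⟪p, y p⟫ • 1`. -/
def vectorState (i : m) (p : P () i) : EndAlg P →CP EndAlg Q :=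
  CompletelyPositiveMap.ofFunctional (τ := Fin (Module.finrank ℂ (P () i)))
    { toFun := fun y => ⟪p, y () i p⟫_ℂ
      map_add' := fun y y' => by
        rw [Pi.add_apply, Pi.add_apply, add_apply, inner_add_right]
      map_smul' := fun c y => by
        rw [Pi.smul_apply, Pi.smul_apply, smul_apply, inner_smul_right, RingHom.id_apply,
          smul_eq_mul] }
    (fun e y => ⟪stdOrthonormalBasis ℂ (P () i) e, y () i p⟫_ℂ) fun x y => by
    change ⟪p, (star x * y) () i p⟫_ℂ = _
    rw [inner_star_mul, ← (stdOrthonormalBasis ℂ (P () i)).sum_inner_mul_inner]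
    refine Finset.sum_congr rfl fun e _ => ?_
    rw [Complex.star_def, inner_conj_symm]

lemma vectorState_apply (i : m) (p : P () i) (y : EndAlg P) :
    vectorState Q i p y = ⟪p, y () i p⟫_ℂ • (1 : EndAlg Q) := rfl

variable [Fintype n] [Fintype n']

/-- A deterministic supermap induces a unital completely positive map of the input algebras. -/
lemma exists_reduction {S : EndAlg (H.box₁ P) →CP EndAlg (K.box₁ Q)}
    (hS : ∀ x, 0 ≤ x → trOut H P x = 1 → trOut K Q (S x) = 1) :
    ∃ 𝒩 : EndAlg P →CP EndAlg Q, 𝒩 1 = 1 ∧ ∀ x, trOut K Q (S x) = 𝒩 (trOut H P x) := by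
  -- If `H = 0`, there is no normalized section. The traces on both sides vanish, so any unital CP
  -- map will do: a vector state when `P ≠ 0`.
  by_cases hd : ∑ j, Module.finrank ℂ (H () j) = 0
  · have hsub : ∀ x : EndAlg (H.box₁ P), x = 0 := by
      intro x
      funext t p
      ext u
      have hp : Module.finrank ℂ (H () p.1) = 0 :=
        Finset.sum_eq_zero_iff.mp hd p.1 (Finset.mem_univ _)
      exact ext_braL (stdOrthonormalBasis ℂ (H () p.1)) fun i => absurd i.2 (by omega)
    have hT : ∀ x, trOut H P x = 0 := fun x => by
      rw [hsub x]
      exact map_zero (trOutₗ H P)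
    have hR : ∀ x, trOut K Q (S x) = 0 := fun x => by
      rw [hsub x]
      exact map_zero (trOutₗ K Q ∘ₗ S.toLinearMap)
    by_cases hP : ∃ i, ∃ p : P () i, p ≠ 0
    · obtain ⟨i, p, hp⟩ := hP
      refine ⟨vectorState Q i (((‖p‖ : ℂ)⁻¹) • p), ?_, fun x => ?_⟩
      · rw [vectorState_apply]
        change ⟪((‖p‖ : ℂ)⁻¹) • p, ((‖p‖ : ℂ)⁻¹) • p⟫_ℂ • (1 : EndAlg Q) = 1
        have h1 : ‖((‖p‖ : ℂ)⁻¹) • p‖ = 1 := norm_smul_inv_norm hp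
        rw [inner_self_eq_norm_sq_to_K, h1, RCLike.ofReal_one, one_pow, one_smul]
      · rw [hR, hT, map_zero]
    · push Not at hP
      have h0 : (1 : EndAlg P) = 0 := by
        funext t i
        ext p
        exact (hP i _).trans (hP i _).symm
      -- When `P = 0` too, `x = 0` already satisfies the trace condition, so the hypothesis on `S`
      -- forces `Q = 0` and the zero map is unital.
      have h1 : (1 : EndAlg Q) = 0 := by
        rw [← hS 0 le_rfl (by rw [hT, h0]), hR]
      refine ⟨CompletelyPositiveMap.ofGram (τ := Empty) 0 (fun _ _ => 0)
        (fun _ _ => by rw [Fintype.sum_empty, LinearMap.zero_apply]), ?_, fun x => ?_⟩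
      · rw [h1]
        rfl
      · rw [hR]
        rfl
  · exact CompletelyPositiveMap.exists_factorization hd (T := trOutₗ H P) trOut_star
      (amplify H P) amplify_one trOut_amplify ((trOutCP K Q).comp S) hS

end Reduction

/-! ### Isometries between families with the same Gram matrix -/

/-- Equal Gram matrices give equal norms to corresponding formal linear combinations of `v` and `w`.
Hence any linear lift of `E` to formal combinations, evaluated on `w`, is isometric. -/
lemma exists_linearIsometry_of_inner_eq {ι E E' : Type*} [NormedAddCommGroup E]
    [InnerProductSpace ℂ E] [NormedAddCommGroup E'] [InnerProductSpace ℂ E'] (v : ι → E)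
    (w : ι → E') (h : ∀ i j, ⟪v i, v j⟫_ℂ = ⟪w i, w j⟫_ℂ)
    (hv : Submodule.span ℂ (Set.range v) = ⊤) : ∃ W : E →ₗᵢ[ℂ] E', ∀ i, W (v i) = w i := by
  let f := Finsupp.linearCombination ℂ v
  let g := Finsupp.linearCombination ℂ w
  have hfg : ∀ a, ‖g a‖ = ‖f a‖ := fun a => by
    have : ⟪f a, f a⟫_ℂ = ⟪g a, g a⟫_ℂ := by
      simp only [f, g, Finsupp.linearCombination_apply, Finsupp.sum, sum_inner, inner_sum,
        inner_smul_left, inner_smul_right, h]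
    rw [inner_self_eq_norm_sq_to_K, inner_self_eq_norm_sq_to_K] at this
    have h2 : ‖f a‖ ^ 2 = ‖g a‖ ^ 2 := Complex.ofReal_injective (by push_cast; exact this)
    exact ((sq_eq_sq₀ (norm_nonneg _) (norm_nonneg _)).mp h2).symm
  have hf : Function.Surjective f := by
    rw [← LinearMap.range_eq_top, Finsupp.range_linearCombination, hv]
  obtain ⟨s, hs⟩ := f.exists_rightInverse_of_surjective (LinearMap.range_eq_top.mpr hf)
  have hs' : ∀ x, f (s x) = x := fun x => LinearMap.congr_fun hs x
  refine ⟨⟨g ∘ₗ s, fun x => ?_⟩, fun i => ?_⟩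
  · rw [LinearMap.comp_apply, hfg, hs']
  · change g (s (v i)) = w i
    -- The lift `s (v i)` need not be `single i 1`, but the two differ by an element of `ker f`,
    -- where `g` vanishes as well.
    have h1 : g (s (v i)) - g (Finsupp.single i 1) = 0 := by
      rw [← map_sub, ← norm_eq_zero, hfg, map_sub, hs', norm_eq_zero, sub_eq_zero]
      simp [f]
    rw [sub_eq_zero.mp h1]
    simp [g]

end TwoFHilb

namespace TwoFHilb

open FHilb

/-! ### Dilations of supermaps -/

section Dilation

variable {m n m' n' : Type} {H : OneMor.{u} Unit n} {P : OneMor.{u} Unit m}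
  {K : OneMor.{u} Unit n'} {Q : OneMor.{u} Unit m'}

lemma braR_sum_tmul {X Y : FHilb.{u}} {ι : Type*} [Fintype ι] (b : OrthonormalBasis ι ℂ X)
    (f : ι → Y) (i : ι) : braR (b i) Y (∑ i', f i' ⊗ₜ[ℂ] b i') = f i := by
  rw [map_sum, Finset.sum_eq_single i]
  · rw [braR_tmul, inner_self_eq_norm_sq_to_K, b.norm_eq_one]
    simp
  · intro i' _ h
    rw [braR_tmul, b.inner_eq_zero h.symm, zero_smul]
  · simp

lemma inner_sum_tmul {X Y : FHilb.{u}} {ι : Type*} [Fintype ι] (b : OrthonormalBasis ι ℂ X)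
    (f g : ι → Y) :
    ⟪(∑ i, f i ⊗ₜ[ℂ] b i : tensor Y X), ∑ i, g i ⊗ₜ[ℂ] b i⟫_ℂ = ∑ i, ⟪f i, g i⟫_ℂ := by
  rw [sum_inner]
  refine Finset.sum_congr rfl fun i _ => ?_
  rw [inner_sum, Finset.sum_eq_single i]
  · rw [TensorProduct.inner_tmul, inner_self_eq_norm_sq_to_K, b.norm_eq_one]
    simp
  · intro i' _ h
    rw [TensorProduct.inner_tmul, b.inner_eq_zero h.symm, mul_zero]
  · simp

lemma span_tmul_leg [Fintype m] (bH : Bases H) {EN : OneMor.{u} m m'} (N : TwoMor Q (P.comp EN))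
    (hN : ∀ i k, Submodule.span ℂ (Set.range fun p : P () i × Q () k => N.leg i k p.1 p.2) = ⊤)
    (j : n) (i : m) (k : m') :
    Submodule.span ℂ (Set.range fun t : Fin (Module.finrank ℂ (H () j)) × P () i × Q () k =>
      bH j t.1 ⊗ₜ[ℂ] N.leg i k t.2.1 t.2.2) = ⊤ := by
  rw [eq_top_iff]
  intro z _
  have hz : ∀ a, ∀ e ∈ Submodule.span ℂ
      (Set.range fun p : P () i × Q () k => N.leg i k p.1 p.2), bH j a ⊗ₜ[ℂ] e ∈
      Submodule.span ℂ (Set.range fun t : Fin (Module.finrank ℂ (H () j)) × P () i × Q () k =>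
        bH j t.1 ⊗ₜ[ℂ] N.leg i k t.2.1 t.2.2) := by
    intro a e he
    induction he using Submodule.span_induction with
    | mem e he =>
      obtain ⟨p, rfl⟩ := he
      exact Submodule.subset_span ⟨(a, p), rfl⟩
    | zero =>
      rw [TensorProduct.tmul_zero]
      exact Submodule.zero_mem _
    | add e e' _ _ h h' =>
      rw [TensorProduct.tmul_add]
      exact Submodule.add_mem _ h h'
    | smul c e _ h =>
      rw [TensorProduct.tmul_smul]
      exact Submodule.smul_mem _ c h
  rw [← sum_tmul_braL (bH j) z]
  exact Submodule.sum_mem _ fun a _ => hz a _ (by rw [hN]; trivial)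

variable [Fintype n]

lemma trOut_matrixUnit [DecidableEq n] [DecidableEq m] (j : n) (i : m) (h h' : H () j)
    (p p' : P () i) :
    trOut H P (matrixUnit (H.box₁ P) (j, i) (h ⊗ₜ[ℂ] p) (h' ⊗ₜ[ℂ] p')) =
      ⟪h', h⟫_ℂ • matrixUnit P i p p' := by
  let b : Bases H := fun j => stdOrthonormalBasis ℂ (H () j)
  refine EndAlg.ext_inner fun i' y y' => ?_
  rw [inner_trOut b, Pi.smul_apply, Pi.smul_apply, smul_apply, inner_smul_right]
  by_cases hi : i' = i
  · subst hi
    rw [matrixUnit_same, Finset.sum_eq_single j]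
    · rw [InnerProductSpace.rankOne_apply, inner_smul_right, ← (b j).sum_inner_mul_inner,
        Finset.sum_mul]
      refine Finset.sum_congr rfl fun a _ => ?_
      rw [matrixUnit_same, InnerProductSpace.rankOne_apply]
      refine (inner_smul_right (E := tensor (H () j) (P () i')) _ _ _).trans ?_
      rw [TensorProduct.inner_tmul, TensorProduct.inner_tmul]
      ring
    · intro j' _ hj
      refine Finset.sum_eq_zero fun a _ => ?_
      rw [matrixUnit_of_ne fun e => hj (congrArg Prod.fst e)]
      exact inner_zero_right _
    · simp
  · rw [matrixUnit_of_ne hi, zero_apply, inner_zero_right, mul_zero]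
    refine Finset.sum_eq_zero fun j' _ => Finset.sum_eq_zero fun a _ => ?_
    rw [matrixUnit_of_ne fun e => hi (congrArg Prod.snd e)]
    exact inner_zero_right _

variable [Fintype m]

lemma TwoMor.ext_leg_tmul (bH : Bases H) (bK : Bases K) {E : OneMor.{u} (n × m) (n' × m')}
    {V V' : TwoMor (K.box₁ Q) ((H.box₁ P).comp E)}
    (h : ∀ (p : n × m) (q : n' × m') a (x : P () p.2) b (y : Q () q.2),
      V.leg p q (bH p.1 a ⊗ₜ[ℂ] x) (bK q.1 b ⊗ₜ[ℂ] y) =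
        V'.leg p q (bH p.1 a ⊗ₜ[ℂ] x) (bK q.1 b ⊗ₜ[ℂ] y)) : V = V' := by
  refine TwoMor.ext_leg
    (fun p : n × m => (bH p.1).tensorProduct (stdOrthonormalBasis ℂ (P () p.2)))
    fun p q ai y => ?_
  rw [OrthonormalBasis.tensorProduct_apply']
  have hsum : ∀ V : TwoMor (K.box₁ Q) ((H.box₁ P).comp E), ∀ x,
      V.leg p q x y = ∑ b, V.leg p q x (bK q.1 b ⊗ₜ[ℂ] braL (bK q.1 b) (Q () q.2) y) := by
    intro V x
    let f := braL x (E p q) ∘L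
      proj (fun p : n × m => tensor (tensor (H () p.1) (P () p.2)) (E p q)) p ∘L V () q
    exact (congrArg f (sum_tmul_braL (bK q.1) y).symm).trans (map_sum f _ _)
  rw [hsum V, hsum V']
  exact Finset.sum_congr rfl fun b _ => h p q ai.1 _ b _

/-- Testing against `⟨a|` on `H_out` and `|b⟩` on `K_out` selects one term of the cup and one of the
cap. The legs are thus the coefficients of `W` on the vectors `|a⟩ ⊗ leg`, so `W` can be read off
from `V`. -/
lemma leg_supermapDilation [DecidableEq n] [DecidableEq m] [Fintype n'] (bH : Bases H)
    (bK : Bases K) {EN : OneMor.{u} m m'} (N : TwoMor Q (P.comp EN))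
    {E : OneMor.{u} (n × m) (n' × m')} (W : TwoMor (preEnv H EN) (postEnv E K))
    (p : n × m) (q : n' × m') (a) (x : P () p.2) (b) (y : Q () q.2) :
    (supermapDilation bH bK N W).leg p q (bH p.1 a ⊗ₜ[ℂ] x) (bK q.1 b ⊗ₜ[ℂ] y) =
      braR (bK q.1 b) (E p q) (proj (fun l => tensor (E p (l, q.2)) (K () l)) q.1
        (W p q.2 (bH p.1 a ⊗ₜ[ℂ] N.leg p.2 q.2 x y))) := by
  have hb : ∀ b', braL (bK q.1 b') (Q () q.2) (bK q.1 b ⊗ₜ[ℂ] y) =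
      if b' = b then y else 0 := fun b' => by
    rw [braL_tmul, orthonormal_iff_ite.mp (bK q.1).orthonormal]
    split_ifs <;> simp
  let g : ∀ (p : n × m) (a : Fin (Module.finrank ℂ (H () p.1))), EN p.2 q.2 →L[ℂ] E p q :=
    fun p a => braR (bK q.1 b) (E p q) ∘L
      proj (fun l => tensor (E p (l, q.2)) (K () l)) q.1 ∘L W p q.2 ∘L
        ketL (bH p.1 a) (EN p.2 q.2)
  have hV : supermapDilation bH bK N W () q (bK q.1 b ⊗ₜ[ℂ] y) =
      ∑ p : n × m, incl (fun p : n × m => tensor (tensor (H () p.1) (P () p.2)) (E p q)) p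
        (∑ a, TensorProduct.mapL (ketL (bH p.1 a) (P () p.2)) (g p a)
          (proj (fun i => tensor (P () i) (EN i q.2)) p.2 (N () q.2 y))) := by
    rw [supermapDilation, sum_apply]
    refine Finset.sum_congr rfl fun p _ => ?_
    rw [sum_apply, map_sum]
    refine Finset.sum_congr rfl fun a _ => ?_
    rw [sum_apply, Finset.sum_eq_single b]
    · simp only [ContinuousLinearMap.comp_apply]
      rw [hb, if_pos rfl]
    · intro b' _ h
      simp only [ContinuousLinearMap.comp_apply]
      rw [hb, if_neg h]
      simp only [map_zero]
    · simp
  have hp := proj_sum_incl (F := fun p : n × m => tensor (tensor (H () p.1) (P () p.2)) (E p q))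
    (fun p => ∑ a, TensorProduct.mapL (ketL (bH p.1 a) (P () p.2)) (g p a)
          (proj (fun i => tensor (P () i) (EN i q.2)) p.2 (N () q.2 y))) p
  rw [TwoMor.leg, hV, hp, map_sum, Finset.sum_eq_single a]
  · rw [braL_mapL, inner_self_eq_norm_sq_to_K, (bH p.1).norm_eq_one, RCLike.ofReal_one, one_pow,
      one_smul]
    rfl
  · intro a' _ h
    rw [braL_mapL, (bH p.1).inner_eq_zero h.symm, zero_smul]
  · simp

variable [Fintype m'] [Fintype n'] [DecidableEq n] [DecidableEq m]

/-- Every Stinespring representation of a map `S` which reduces to `𝒩` arises from a minimal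
Stinespring representation of `𝒩` by an isometry of environments. -/
lemma exists_eq_supermapDilation (bH : Bases H) (bK : Bases K)
    {S : EndAlg (H.box₁ P) →CP EndAlg (K.box₁ Q)} {𝒩 : EndAlg P →CP EndAlg Q}
    (hred : ∀ x, trOut K Q (S x) = 𝒩 (trOut H P x))
    {EN : OneMor.{u} m m'} {N : TwoMor Q (P.comp EN)} (hN : IsStinespring 𝒩 EN N)
    (hspan : ∀ i k, Submodule.span ℂ
      (Set.range fun p : P () i × Q () k => N.leg i k p.1 p.2) = ⊤)
    {E : OneMor.{u} (n × m) (n' × m')} {V : TwoMor (K.box₁ Q) ((H.box₁ P).comp E)}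
    (hV : IsStinespring S E V) :
    ∃ W : TwoMor (preEnv H EN) (postEnv E K),
      W.IsIsometry ∧ V = supermapDilation bH bK N W := by
  -- The images that `leg_supermapDilation` forces on `W`: the wire `K_out` of `V` is bent round to
  -- the output by summing over its basis.
  let w : ∀ (p : n × m) (k : m'),
      Fin (Module.finrank ℂ (H () p.1)) × P () p.2 × Q () k → postEnv E K p k :=
    fun p k t => WithLp.toLp 2 fun l =>
      ∑ b, V.leg p (l, k) (bH p.1 t.1 ⊗ₜ[ℂ] t.2.1) (bK l b ⊗ₜ[ℂ] t.2.2) ⊗ₜ[ℂ] bK l b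
  have gram : ∀ p k t t', ⟪bH p.1 t.1 ⊗ₜ[ℂ] N.leg p.2 k t.2.1 t.2.2,
      bH p.1 t'.1 ⊗ₜ[ℂ] N.leg p.2 k t'.2.1 t'.2.2⟫_ℂ = ⟪w p k t, w p k t'⟫_ℂ := by
    intro p k t t'
    have h1 : ⟪w p k t, w p k t'⟫_ℂ = ∑ l, ∑ b, ⟪bK l b ⊗ₜ[ℂ] t.2.2,
        S (matrixUnit (H.box₁ P) p (bH p.1 t.1 ⊗ₜ[ℂ] t.2.1) (bH p.1 t'.1 ⊗ₜ[ℂ] t'.2.1)) ()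
          (l, k) (bK l b ⊗ₜ[ℂ] t'.2.2)⟫_ℂ := by
      rw [PiLp.inner_apply]
      refine Finset.sum_congr rfl fun l _ => (inner_sum_tmul (bK l) _ _).trans ?_
      exact Finset.sum_congr rfl fun b _ => (hV.inner_matrixUnit p _ _ (l, k) _ _).symm
    -- The sum over `l` and `b` is the partial trace over `K_out`. The reduction turns it into `𝒩`
    -- of a matrix unit with factor `⟪a', a⟫`, which equals `⟪a, a'⟫` because basis vectors have
    -- inner products `0` or `1`.
    rw [h1, ← inner_trOut bK, hred, trOut_matrixUnit, map_smul, Pi.smul_apply, Pi.smul_apply,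
      smul_apply, inner_smul_right, hN.inner_matrixUnit, TensorProduct.inner_tmul,
      orthonormal_iff_ite.mp (bH p.1).orthonormal, orthonormal_iff_ite.mp (bH p.1).orthonormal]
    simp only [eq_comm]
  choose W hW using fun p k =>
    exists_linearIsometry_of_inner_eq _ (w p k) (gram p k) (span_tmul_leg bH N hspan p.1 p.2 k)
  refine ⟨fun p k => (W p k).toContinuousLinearMap, ?_, ?_⟩
  · funext p k
    exact (W p k).adjoint_comp_self
  · refine TwoMor.ext_leg_tmul bH bK fun p q a x b y => ?_
    rw [leg_supermapDilation]
    have h := hW p q.2 (a, x, y)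
    refine Eq.trans ?_ (congrArg (fun z => braR (bK q.1 b) (E p q)
      (proj (fun l => tensor (E p (l, q.2)) (K () l)) q.1 z)) h.symm)
    exact (braR_sum_tmul (bK q.1) (fun b =>
      V.leg p q (bH p.1 a ⊗ₜ[ℂ] x) (bK q.1 b ⊗ₜ[ℂ] y)) b).symm

/-- Evaluating the Stinespring equation at `1` gives `N† N = 𝒩 1`. -/
lemma IsStinespring.isIsometry {𝒩 : EndAlg P →CP EndAlg Q} (h1 : 𝒩 1 = 1) {EN : OneMor.{u} m m'}
    {N : TwoMor Q (P.comp EN)} (hN : IsStinespring 𝒩 EN N) : N.IsIsometry := by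
  have h := hN 1
  rw [h1] at h
  have hw : (TwoMor.whisker (1 : EndAlg P) EN).comp N = N := by
    funext t k
    ext y : 1
    refine ext_proj (F := fun i => tensor (P () i) (EN i k)) fun i => ?_
    refine (proj_whisker (1 : EndAlg P) k (N () k y) i).trans ?_
    exact congrArg (fun f : tensor (P () i) (EN i k) →L[ℂ] tensor (P () i) (EN i k) =>
      f (proj (fun i => tensor (P () i) (EN i k)) i (N () k y)))
      (ContinuousLinearMap.rTensor_one _)
  rw [hw] at h
  exact h.symm

end Dilation

end TwoFHilb

end

theorem theorem2 {m n m' n' : Type} [Fintype m] [DecidableEq m] [Fintype n] [DecidableEq n]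
    [Fintype m'] [DecidableEq m'] [Fintype n'] [DecidableEq n']
    (HIn : TwoFHilb.OneMor.{u} Unit m) (HOut : TwoFHilb.OneMor.{u} Unit n)
    (KIn : TwoFHilb.OneMor.{u} Unit m') (KOut : TwoFHilb.OneMor.{u} Unit n')
    (bH : TwoFHilb.Bases HOut) (bK : TwoFHilb.Bases KOut)
    (S : TwoFHilb.ChoiAlg HOut HIn →CP TwoFHilb.ChoiAlg KOut KIn)
    (hS : TwoFHilb.IsDeterministicSupermap S) :
    ∃ 𝒩 : TwoFHilb.EndAlg HIn.hat →CP TwoFHilb.EndAlg KIn.hat,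
      𝒩 1 = 1 ∧
      (∀ x : TwoFHilb.ChoiAlg HOut HIn,
        TwoFHilb.trOut KOut KIn.hat (S x) = 𝒩 (TwoFHilb.trOut HOut HIn.hat x)) ∧
      ∃ (EN : TwoFHilb.OneMor.{u} m m') (N : TwoFHilb.TwoMor KIn.hat (HIn.hat.comp EN)),
        TwoFHilb.IsMinimalStinespring 𝒩 EN N ∧
        N.IsIsometry ∧
        (∃ (E : TwoFHilb.OneMor.{u} (n × m) (n' × m'))
          (W : TwoFHilb.TwoMor (TwoFHilb.preEnv HOut EN) (TwoFHilb.postEnv E KOut)),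
          W.IsIsometry ∧
          TwoFHilb.IsStinespring S E (TwoFHilb.supermapDilation bH bK N W)) ∧
        (∀ (E : TwoFHilb.OneMor.{u} (n × m) (n' × m'))
          (V : TwoFHilb.TwoMor (KOut.box₁ KIn.hat) ((HOut.box₁ HIn.hat).comp E)),
          TwoFHilb.IsStinespring S E V →
          ∃ W : TwoFHilb.TwoMor (TwoFHilb.preEnv HOut EN) (TwoFHilb.postEnv E KOut),
            W.IsIsometry ∧ V = TwoFHilb.supermapDilation bH bK N W) := by
  obtain ⟨𝒩, h1, hred⟩ := TwoFHilb.exists_reduction hS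
  obtain ⟨EN, N, hN, hspan⟩ := TwoFHilb.exists_stinespring 𝒩
  refine ⟨𝒩, h1, hred, EN, N, ⟨hN, TwoFHilb.exists_inverse_envGram N hspan⟩,
    hN.isIsometry h1, ?_, fun E V hV =>
      TwoFHilb.exists_eq_supermapDilation bH bK hred hN hspan hV⟩
  -- Existence follows from the universal statement applied to any Stinespring representation of
  -- `S`; its minimality plays no role.
  obtain ⟨E, V, hV, -⟩ := TwoFHilb.exists_stinespring S
  obtain ⟨W, hW, hVW⟩ := TwoFHilb.exists_eq_supermapDilation bH bK hred hN hspan hV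
  exact ⟨E, W, hW, hVW ▸ hV⟩
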